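/- Let $B_n$ be the braid group of the disc on $n$ strands, with Artin generators $\sigma_1,\dots,\sigma_{n-1}$, and $P_n\le B_n$ the pure braid group. For $1\le i\le n$ let $d_i\colon B_n\to B_{n-1}$ be the operation of deleting the $i$-th strand (the strand starting in position $i$), so that $d_i(\beta\gamma)=d_i(\beta)\,d_{i\cdot\beta}(\gamma)$, where $i\cdot\beta$ is the end position of the $i$-th strand of $\beta$. Put $$\mathrm{Brun}_n=\{\beta\in B_n: d_1\beta=\dots=d_n\beta=1\},\qquad \mathfrak H_n^B=\{\beta\in B_n: d_1\beta=\dots=d_n\beta\},\qquad \mathfrak H_n=\mathfrak H_n^B\cap P_n,$$ and let $\Delta_n=(\sigma_1\cdots\sigma_{n-1})(\sigma_1\cdots\sigma_{n-2})\cdots(\sigma_1\sigma_2)\sigma_1$ be the half twist. Let $A_{s,t}=\sigma_{t-1}\cdots\sigma_{s+1}\sigma_s^2\sigma_{s+1}^{-1}\cdots\sigma_{t-1}^{-1}$ ($1\le s<t\le n$) be the standard generators of $P_n$. For $1\le i\le n+1$ let $d^i\colon B_n\to B_{n+1}$ be the coface homomorphism (adding a trivial strand in position $i$): $d^i\sigma_j=\sigma_j$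 for $j<i-1$, $d^i\sigma_{i-1}=\sigma_i\sigma_{i-1}\sigma_i^{-1}$, and $d^i\sigma_j=\sigma_{j+1}$ for $j\ge i$. For $i\le n$ write $w^{f_i}=d^i(w)$; it is the substitution $A_{s,t}\mapsto A_{f_i(s),f_i(t)}$, where $f_i(k)=k$ for $k<i$ and $f_i(k)=k+1$ for $k\ge i$. For $3\le m\le k$ and $\alpha\in\mathrm{Brun}_m$ let $$\tau_{m,k}(\alpha)=\prod_{1\le i_1<\dots<i_{k-m}\le k-1}\alpha^{f_{i_1}f_{i_2}\cdots f_{i_{k-m}}}\in B_k$$ ($f_{i_1}$ is applied first, and the factors are in lexicographic order of $(i_1,\dots,i_{k-m})$), so $\tau_{m,m}(\alpha)=\alpha$, and for $3\le m\le n$, with $B_k\subseteq B_n$ by $\sigma_j\mapsto\sigma_j$, let $$T_{m,n}(\alpha)=\tau_{m,m}(\alpha)\,\tau_{m,m+1}(\alpha)\cdots\tau_{m,n}(\alpha).$$ **Theorem.** Let $n\ge 3$. For $3\le m\le n$, $T_{m,n}$ maps $\mathrm{Brun}_m$ into $\mathfrak H_n$, and if $m<n$ then $d_i(T_{m,n}(\alpha))=T_{m,n-1}(\alpha)$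 for all $\alpha\in\mathrm{Brun}_m$ and $1\le i\le n$ (and $T_{m,m}(\alpha)=\alpha$). Moreover, for any generating sets $GB_m$ of $\mathrm{Brun}_m$, $3\le m\le n$: 1. the group $\mathfrak H_n$ of pure Cohen braids is generated by $\Delta_n^2$ together with $T_{3,n}(GB_3)\cup T_{4,n}(GB_4)\cup\dots\cup T_{n-1,n}(GB_{n-1})\cup GB_n$; 2. the group $\mathfrak H_n^B$ of all Cohen braids is generated by $\Delta_n$ together with $T_{3,n}(GB_3)\cup T_{4,n}(GB_4)\cup\dots\cup T_{n-1,n}(GB_{n-1})\cup GB_n$. -/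

import Mathlib

/-- The Artin relations on `n` strands. Generators and strands are numbered from `0`: the generator
`j` with `j + 1 < n` is the elementary crossing of the strands in positions `j` and `j + 1`. -/
def braidRels (n : ℕ) : Set (FreeGroup (Fin (n - 1))) :=
  {r | ∃ i j : Fin (n - 1), (i : ℕ) + 1 < j ∧
      r = FreeGroup.of i * FreeGroup.of j * (FreeGroup.of j * FreeGroup.of i)⁻¹} ∪
  {r | ∃ i j : Fin (n - 1), (i : ℕ) + 1 = j ∧
      r = FreeGroup.of i * FreeGroup.of j * FreeGroup.of i *
        (FreeGroup.of j * FreeGroup.of i * FreeGroup.of j)⁻¹}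

/-- The braid group `B_n` of the disc, by Artin's presentation. -/
abbrev BraidGroup (n : ℕ) : Type := PresentedGroup (braidRels n)

namespace BraidGroup

/-- The generator `σ_j` of `B_n` for `j + 1 < n` (positions numbered from `0`); the value `1` for
other `j` is never used. -/
def σ (n j : ℕ) : BraidGroup n :=
  if h : j + 1 < n then PresentedGroup.of ⟨j, by omega⟩ else 1

theorem σ_comm (n i j : ℕ) (hij : i + 1 < j) : σ n i * σ n j = σ n j * σ n i := by
  by_cases hj : j + 1 < n
  · have hi : i + 1 < n := by omega
    simp only [σ, hi, hj, dite_true]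
    have := PresentedGroup.one_of_mem (rels := braidRels n)
      (Or.inl ⟨⟨i, by omega⟩, ⟨j, by omega⟩, hij, rfl⟩)
    simp only [map_mul, map_inv] at this
    exact mul_inv_eq_one.mp this
  · simp [σ, hj]

theorem σ_braid (n i : ℕ) (hi : i + 2 < n) :
    σ n i * σ n (i + 1) * σ n i = σ n (i + 1) * σ n i * σ n (i + 1) := by
  have h1 : i + 1 < n := by omega
  have h2 : i + 1 + 1 < n := by omega
  simp only [σ, h1, h2, dite_true]
  have := PresentedGroup.one_of_mem (rels := braidRels n)
    (Or.inr ⟨⟨i, by omega⟩, ⟨i + 1, by omega⟩, rfl, rfl⟩)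
  simp only [map_mul, map_inv] at this
  exact mul_inv_eq_one.mp this

/-- The homomorphism out of `B_n` with prescribed values `σ_j ↦ f j`, for values that satisfy the
Artin relations. -/
def lift {G : Type*} [Group G] (n : ℕ) (f : ℕ → G)
    (hc : ∀ i j, i + 1 < j → j + 1 < n → f i * f j = f j * f i)
    (hb : ∀ i, i + 2 < n → f i * f (i + 1) * f i = f (i + 1) * f i * f (i + 1)) :
    BraidGroup n →* G :=
  PresentedGroup.toGroup (f := fun j : Fin (n - 1) => f j) (by
    rintro r (⟨i, j, hij, rfl⟩ | ⟨i, j, hij, rfl⟩)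
    · simp only [map_mul, map_inv, FreeGroup.lift_apply_of]
      rw [mul_inv_eq_one]
      exact hc i j hij (by omega)
    · simp only [map_mul, map_inv, FreeGroup.lift_apply_of]
      rw [mul_inv_eq_one, ← hij]
      exact hb i (by omega))

theorem lift_σ {G : Type*} [Group G] (n : ℕ) (f : ℕ → G) (hc) (hb) (j : ℕ) (hj : j + 1 < n) :
    lift n f hc hb (σ n j) = f j := by
  simp [lift, σ, hj]

/-! ### Permutations and pure braids -/

/-- The transposition of the positions `j` and `j + 1`. -/
def adjSwap (n j : ℕ) : Equiv.Perm (Fin n) :=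
  if h : j + 1 < n then Equiv.swap ⟨j, by omega⟩ ⟨j + 1, h⟩ else 1

theorem adjSwap_val (n j : ℕ) (h : j + 1 < n) (x : Fin n) :
    ((adjSwap n j x : Fin n) : ℕ) =
      if (x : ℕ) = j then j + 1 else if (x : ℕ) = j + 1 then j else x := by
  simp only [adjSwap, h, dite_true, Equiv.swap_apply_def, Fin.ext_iff]
  split_ifs <;> rfl

theorem adjSwap_inv (n j : ℕ) : (adjSwap n j)⁻¹ = adjSwap n j := by
  unfold adjSwap
  split_ifs <;> simp

theorem adjSwap_comm (n i j : ℕ) (hij : i + 1 < j) (hj : j + 1 < n) :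
    adjSwap n i * adjSwap n j = adjSwap n j * adjSwap n i := by
  have hi : i + 1 < n := by omega
  ext x
  simp only [Equiv.Perm.mul_apply, adjSwap_val n i hi, adjSwap_val n j hj]
  split_ifs <;> omega

theorem adjSwap_braid (n i : ℕ) (hi : i + 2 < n) :
    adjSwap n i * adjSwap n (i + 1) * adjSwap n i =
      adjSwap n (i + 1) * adjSwap n i * adjSwap n (i + 1) := by
  have h1 : i + 1 < n := by omega
  have h2 : i + 1 + 1 < n := by omega
  ext x
  simp only [Equiv.Perm.mul_apply, adjSwap_val n i h1, adjSwap_val n (i + 1) h2]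
  split_ifs <;> omega

/-- The permutation of a braid, `σ_j ↦ (j, j + 1)`. The strand of `β` that starts in position `i`
ends in position `(perm n β)⁻¹ i`. -/
def perm (n : ℕ) : BraidGroup n →* Equiv.Perm (Fin n) :=
  lift n (adjSwap n) (adjSwap_comm n) (adjSwap_braid n)

/-- The pure braid group `P_n`. -/
def pure (n : ℕ) : Subgroup (BraidGroup n) := (perm n).ker

/-! ### Deleting a strand -/

/-- The braid on `n - 1` strands left after deleting from `σ_j` the strand that starts in
position `i`. -/
def delGen (n j : ℕ) (i : Fin n) : BraidGroup (n - 1) :=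
  if (i : ℕ) < j then σ (n - 1) (j - 1) else if j + 1 < (i : ℕ) then σ (n - 1) j else 1

/-- All strand deletions, together with the permutation, as one homomorphism
`β ↦ (i ↦ d_i β, perm β)` into the semidirect product of the functions on strands with the
permutations. The product of that group encodes the rule `d_i (β γ) = d_i β * d_{i·β} γ`, where
`i·β` is the end position of the strand of `β` that starts in position `i`. -/
def delHom (n : ℕ) : BraidGroup n →*
    (Fin n → BraidGroup (n - 1)) ⋊[mulAutArrow (M := BraidGroup (n - 1))] Equiv.Perm (Fin n) :=
  lift n (fun j => ⟨delGen n j, adjSwap n j⟩)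
    (by
      intro i j hij hj
      have hi : i + 1 < n := by omega
      refine SemidirectProduct.ext ?_ (adjSwap_comm n i j hij hj)
      funext x
      simp only [SemidirectProduct.mul_left, Pi.mul_apply]
      change delGen n i x * delGen n j ((adjSwap n i)⁻¹ x) =
        delGen n j x * delGen n i ((adjSwap n j)⁻¹ x)
      rw [adjSwap_inv, adjSwap_inv]
      simp only [delGen, adjSwap_val n i hi, adjSwap_val n j hj]
      generalize (x : ℕ) = v
      have hv : v < i ∨ v = i ∨ v = i + 1 ∨ (i + 1 < v ∧ v < j) ∨ v = j ∨ v = j + 1 ∨ j + 1 < v := by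
        omega
      rcases hv with hv | rfl | rfl | hv | rfl | rfl | hv
      · have hc := σ_comm (n - 1) (i - 1) (j - 1) (by omega)
        simpa [hv, hv.ne, show v ≠ i + 1 by omega, show v ≠ j by omega, show v ≠ j + 1 by omega,
          show v < j by omega] using hc
      · simp [show v ≠ j by omega, show v ≠ j + 1 by omega, show v < j by omega, hij]
      · simp [show i + 1 ≠ j by omega, show i ≠ j by omega, show i < j by omega, hij]
      · have hc := σ_comm (n - 1) i (j - 1) (by omega)
        simpa [hv, show v ≠ i by omega, show v ≠ i + 1 by omega, show v ≠ j by omega,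
          show v ≠ j + 1 by omega, show ¬ v < i by omega] using hc
      · simp [show v ≠ i by omega, show v ≠ i + 1 by omega, show ¬ v < i by omega,
          show ¬ v + 1 < i by omega,
          show i + 1 < v by omega, show i < v by omega]
      · simp [show j ≠ i by omega, show ¬ j < i by omega,
          show j + 1 ≠ i by omega, show ¬ j + 1 < i by omega,
          show i + 1 < j by omega, show i < j by omega]
      · have hc := σ_comm (n - 1) i j (by omega)
        simpa [hv, show v ≠ i by omega, show v ≠ i + 1 by omega, show v ≠ j by omega,
          show v ≠ j + 1 by omega, show ¬ v < i by omega, show ¬ v < j by omega,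
          show i + 1 < v by omega] using hc)
    (by
      intro i hi
      have h1 : i + 1 < n := by omega
      have h2 : i + 1 + 1 < n := by omega
      refine SemidirectProduct.ext ?_ (adjSwap_braid n i hi)
      funext x
      simp only [SemidirectProduct.mul_left, SemidirectProduct.mul_right, Pi.mul_apply]
      change delGen n i x * delGen n (i + 1) ((adjSwap n i)⁻¹ x) *
          delGen n i ((adjSwap n i * adjSwap n (i + 1))⁻¹ x) =
        delGen n (i + 1) x * delGen n i ((adjSwap n (i + 1))⁻¹ x) *
          delGen n (i + 1) ((adjSwap n (i + 1) * adjSwap n i)⁻¹ x)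
      rw [mul_inv_rev, mul_inv_rev, adjSwap_inv, adjSwap_inv, Equiv.Perm.mul_apply,
        Equiv.Perm.mul_apply]
      simp only [delGen, adjSwap_val n i h1, adjSwap_val n (i + 1) h2]
      have hx := x.2
      generalize (x : ℕ) = v at hx ⊢
      have hv : v < i ∨ v = i ∨ v = i + 1 ∨ v = i + 2 ∨ i + 2 < v := by omega
      rcases hv with hv | rfl | rfl | rfl | hv
      · have hb := σ_braid (n - 1) (i - 1) (by omega)
        rw [show i - 1 + 1 = i by omega] at hb
        simpa [hv, hv.ne, show v ≠ i + 1 by omega, show v ≠ i + 2 by omega,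
          show v < i + 1 by omega] using hb
      · simp [show ¬ v + 1 + 1 < v by omega, show v ≠ v + 1 + 1 by omega]
      · simp [show ¬ i + 1 + 1 < i by omega, show i ≠ i + 1 + 1 by omega,
          show i + 1 + 1 ≠ i by omega]
      · simp
      · have hb := σ_braid (n - 1) i (by omega)
        simpa [hv, hv.ne', show v ≠ i by omega, show v ≠ i + 1 by omega, show ¬ v < i by omega,
          show ¬ v < i + 1 by omega, show i + 1 < v by omega, show i + 1 + 1 < v by omega] using hb)

/-- `d_i β`: the braid obtained from `β` by deleting the strand that starts in position `i`. -/
def del {n : ℕ} (i : Fin n) (β : BraidGroup n) : BraidGroup (n - 1) := (delHom n β).left i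

theorem delHom_right (n : ℕ) (β : BraidGroup n) : (delHom n β).right = perm n β := by
  have h : SemidirectProduct.rightHom.comp (delHom n) = perm n := by
    refine PresentedGroup.ext fun j => ?_
    simp [delHom, perm, lift]
  exact DFunLike.congr_fun h β

theorem del_σ (n j : ℕ) (hj : j + 1 < n) (i : Fin n) : del i (σ n j) = delGen n j i := by
  simp [del, delHom, lift_σ n _ _ _ j hj]

theorem del_one {n : ℕ} (i : Fin n) : del i (1 : BraidGroup n) = 1 := by
  simp [del]

theorem del_mul {n : ℕ} (i : Fin n) (β γ : BraidGroup n) :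
    del i (β * γ) = del i β * del ((perm n β)⁻¹ i) γ := by
  simp only [del, map_mul, SemidirectProduct.mul_left, Pi.mul_apply, ← delHom_right]
  rfl

theorem del_inv {n : ℕ} (i : Fin n) (β : BraidGroup n) :
    del i β⁻¹ = (del (perm n β i) β)⁻¹ := by
  have h := del_mul i β⁻¹ β
  rw [inv_mul_cancel, del_one, map_inv, inv_inv] at h
  exact eq_inv_of_mul_eq_one_left h.symm

/-! ### Brunnian braids and Cohen braids -/

/-- `Brun_n`: the braids that become trivial after deleting any one strand. -/
def brunnian (n : ℕ) : Subgroup (BraidGroup n) where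
  carrier := {β | ∀ i : Fin n, del i β = 1}
  mul_mem' {β γ} hβ hγ i := by rw [del_mul, hβ, hγ, one_mul]
  one_mem' i := del_one i
  inv_mem' {β} hβ i := by rw [del_inv, hβ, inv_one]

/-- `𝔥ᴮ_n`: the Cohen braids, that is, the braids with `d_1 β = ⋯ = d_n β`. -/
def cohen (n : ℕ) : Subgroup (BraidGroup n) where
  carrier := {β | ∀ i j : Fin n, del i β = del j β}
  mul_mem' {β γ} hβ hγ i j := by
    rw [del_mul, del_mul, hβ i j, hγ ((perm n β)⁻¹ i) ((perm n β)⁻¹ j)]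
  one_mem' i j := by rw [del_one, del_one]
  inv_mem' {β} hβ i j := by rw [del_inv, del_inv, hβ]

/-- `𝔥_n = 𝔥ᴮ_n ∩ P_n`: the pure Cohen braids. -/
def pureCohen (n : ℕ) : Subgroup (BraidGroup n) := cohen n ⊓ pure n

/-- The half twist `Δ_n = (σ_1 σ_2 ⋯ σ_{n-1}) (σ_1 ⋯ σ_{n-2}) ⋯ (σ_1 σ_2) σ_1`
(here with generators numbered from `0`). -/
def halfTwist (n : ℕ) : BraidGroup n :=
  ((List.range (n - 1)).reverse.map fun r => ((List.range (r + 1)).map (σ n)).prod).prod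

/-! ### The substitutions `w ↦ w ^ f_i` -/

/-- Values of the coface `d^p` on the generators. -/
def cofaceGen (n p j : ℕ) : BraidGroup (n + 1) :=
  if j + 1 < p then σ (n + 1) j
  else if j + 1 = p then σ (n + 1) p * σ (n + 1) j * (σ (n + 1) p)⁻¹
  else σ (n + 1) (j + 1)

/-- The coface `d^p : B_n → B_{n+1}`, which adds a trivial strand in position `p ≤ n`. It sends
`A_{s,t}` to `A_{f(s),f(t)}`, where `f = f_p` is the increasing map that skips `p`
(`coface_pureGen` below), so that on a word `w` in the free generators `A_{j,n}` of `U_n` it is the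
substitution `w ↦ w ^ f_p`. -/
def coface (n p : ℕ) : BraidGroup n →* BraidGroup (n + 1) :=
  lift n (cofaceGen n p)
    (by
      intro i j hij hj
      have h1 := σ_comm (n + 1) i j hij
      have h2 := σ_comm (n + 1) i (j + 1) (by omega)
      have h3 := σ_comm (n + 1) (i + 1) (j + 1) (by omega)
      have hp : j + 1 < p ∨ p = j + 1 ∨ (i + 1 < p ∧ p < j + 1) ∨ p = i + 1 ∨ p < i + 1 := by omega
      rcases hp with hp | rfl | hp | rfl | hp
      · simpa [cofaceGen, hp, show i + 1 < p by omega] using h1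
      · have : Commute (σ (n + 1) i) (σ (n + 1) (j + 1) * σ (n + 1) j * (σ (n + 1) (j + 1))⁻¹) :=
          (Commute.mul_right h2 h1).mul_right (Commute.inv_right h2)
        simpa [cofaceGen, show i < j by omega] using this.eq
      · simpa [cofaceGen, hp.1, show ¬ j + 1 < p by omega, show j + 1 ≠ p by omega] using h2
      · have : Commute (σ (n + 1) (i + 1) * σ (n + 1) i * (σ (n + 1) (i + 1))⁻¹)
            (σ (n + 1) (j + 1)) :=
          (Commute.mul_left h3 h2).mul_left (Commute.inv_left h3)
        simpa [cofaceGen, show ¬ j < i by omega, show j ≠ i by omega] using this.eq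
      · simpa [cofaceGen, show ¬ j + 1 < p by omega, show j + 1 ≠ p by omega,
          show ¬ i + 1 < p by omega, show i + 1 ≠ p by omega] using h3)
    (by
      intro i hi
      have h1 := σ_braid (n + 1) i (by omega)
      have h2 := σ_braid (n + 1) (i + 1) (by omega)
      have h3 := σ_comm (n + 1) i (i + 2) (by omega)
      have hp : i + 2 < p ∨ p = i + 2 ∨ p = i + 1 ∨ p < i + 1 := by omega
      rcases hp with hp | rfl | rfl | hp
      · simpa [cofaceGen, show i + 1 < p by omega, show i + 1 + 1 < p by omega] using h1
      · have ha : σ (n + 1) (i + 2) * σ (n + 1) i * (σ (n + 1) (i + 2))⁻¹ = σ (n + 1) i := by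
          rw [← h3, mul_inv_cancel_right]
        have h := congrArg (MulAut.conj (σ (n + 1) (i + 2))) h1
        simp only [map_mul, MulAut.conj_apply, ha] at h
        simpa [cofaceGen] using h
      · have ha : (σ (n + 1) i)⁻¹ * σ (n + 1) (i + 2) * ((σ (n + 1) i)⁻¹)⁻¹ =
            σ (n + 1) (i + 2) := by
          rw [inv_inv, mul_assoc, ← h3, inv_mul_cancel_left]
        have hb : (σ (n + 1) i)⁻¹ * σ (n + 1) (i + 1) * ((σ (n + 1) i)⁻¹)⁻¹ =
            σ (n + 1) (i + 1) * σ (n + 1) i * (σ (n + 1) (i + 1))⁻¹ := by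
          rw [inv_inv, eq_mul_inv_iff_mul_eq, mul_assoc, mul_assoc, inv_mul_eq_iff_eq_mul,
            ← mul_assoc, ← mul_assoc, h1]
        have h := congrArg (MulAut.conj (σ (n + 1) i)⁻¹) h2
        simp only [map_mul, MulAut.conj_apply, ha, hb] at h
        simpa [cofaceGen] using h
      · simpa [cofaceGen, show ¬ i + 1 < p by omega, show i + 1 ≠ p by omega,
          show ¬ i + 1 + 1 < p by omega, show i + 1 + 1 ≠ p by omega] using h2)

theorem coface_σ (n p j : ℕ) (hj : j + 1 < n) : coface n p (σ n j) = cofaceGen n p j :=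
  lift_σ n _ _ _ j hj

/-- The standard generator `A_{i,i+d+1} = σ_{i+d} ⋯ σ_{i+1} σ_i² σ_{i+1}⁻¹ ⋯ σ_{i+d}⁻¹` of `P_n`. -/
def pureGen (n i : ℕ) : ℕ → BraidGroup n
  | 0 => σ n i ^ 2
  | d + 1 => σ n (i + d + 1) * pureGen n i d * (σ n (i + d + 1))⁻¹

theorem commute_σ_pureGen (n i d k : ℕ) (hk : i + d + 1 < k) :
    Commute (σ n k) (pureGen n i d) := by
  induction d with
  | zero => exact Commute.pow_right (σ_comm n i k (by omega)).symm 2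
  | succ d ih =>
    have h : Commute (σ n k) (σ n (i + d + 1)) := (σ_comm n (i + d + 1) k (by omega)).symm
    exact (h.mul_right (ih (by omega))).mul_right h.inv_right

/-- `d^p A_{s,t} = A_{f(s),f(t)}`, where `f` is the increasing map that skips `p`. -/
theorem coface_pureGen (n p i d : ℕ) (h : i + d + 1 < n) :
    coface n p (pureGen n i d) =
      if p ≤ i then pureGen (n + 1) (i + 1) d
      else if p ≤ i + d + 1 then pureGen (n + 1) i (d + 1)
      else pureGen (n + 1) i d := by
  induction d with
  | zero =>
    have h1 := σ_braid (n + 1) i (by omega)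
    rw [pureGen, map_pow, coface_σ n p i (by omega)]
    have hp : p ≤ i ∨ p = i + 1 ∨ i + 1 < p := by omega
    rcases hp with hp | rfl | hp
    · simp [cofaceGen, hp, show ¬ i + 1 < p by omega, show i + 1 ≠ p by omega, pureGen]
    · simp [cofaceGen, pureGen, pow_two, mul_assoc]
    · simp [cofaceGen, hp, show ¬ p ≤ i by omega, show ¬ p ≤ i + 1 by omega, pureGen]
  | succ d ih =>
    rw [pureGen, map_mul, map_mul, map_inv, coface_σ n p _ (by omega), ih (by omega)]
    have hp : p ≤ i ∨ (i < p ∧ p ≤ i + d + 1) ∨ p = i + d + 2 ∨ i + d + 2 < p := by omega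
    rcases hp with hp | hp | rfl | hp
    · simp [cofaceGen, hp, show ¬ i + d + 1 + 1 < p by omega, show i + d + 1 + 1 ≠ p by omega,
        pureGen, show i + 1 + d + 1 = i + d + 1 + 1 by omega]
    · simp [cofaceGen, hp.2, show ¬ p ≤ i by omega, show ¬ i + d + 1 + 1 < p by omega,
        show i + d + 1 + 1 ≠ p by omega, pureGen,
        show i + (d + 1) + 1 = i + d + 1 + 1 by omega]
    · have hc := (commute_σ_pureGen (n + 1) i d (i + d + 2) (by omega)).eq
      have hc' (x : BraidGroup (n + 1)) : (σ (n + 1) (i + d + 2))⁻¹ *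
          (pureGen (n + 1) i d * (σ (n + 1) (i + d + 2) * x)) = pureGen (n + 1) i d * x := by
        rw [← mul_assoc (pureGen (n + 1) i d), ← hc, mul_assoc, inv_mul_cancel_left]
      simp [cofaceGen, show ¬ i + d + 2 ≤ i by omega, show ¬ i + d + 2 ≤ i + d + 1 by omega, pureGen,
        mul_assoc, hc',
        show i + (d + 1) + 1 = i + d + 2 by omega]
    · simp [cofaceGen, hp, show ¬ p ≤ i by omega, show ¬ p ≤ i + d + 1 by omega,
        show ¬ p ≤ i + (d + 1) + 1 by omega, pureGen]

/-- The canonical inclusion `B_k → B_n`, `σ_j ↦ σ_j`, for `k ≤ n`. -/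
def incl {k n : ℕ} (h : k ≤ n) : BraidGroup k →* BraidGroup n :=
  lift k (σ n) (fun i j hij _ => σ_comm n i j hij) (fun i hi => σ_braid n i (by omega))

/-- `α ↦ α ^ (f_{i_1} f_{i_2} ⋯ f_{i_s})`, with `f_{i_1}` applied first: for `B_m → B_{m+s}`. -/
def cofaces (m : ℕ) : (s : ℕ) → (Fin s → ℕ) → (BraidGroup m →* BraidGroup (m + s))
  | 0, _ => MonoidHom.id _
  | s + 1, i => (coface (m + s) (i (Fin.last s))).comp (cofaces m s (Fin.init i))

/-- The sequences of `s` entries taken from left to right out of the list `l`, in lexicographic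
order. For `l = [0, …, N - 1]` these are the sequences `i_1 < ⋯ < i_s < N`. -/
def lexSeqs : (s : ℕ) → List ℕ → List (Fin s → ℕ)
  | 0, _ => [Fin.elim0]
  | _ + 1, [] => []
  | s + 1, a :: l => (lexSeqs s l).map (fun i => (Fin.cons a i : Fin (s + 1) → ℕ)) ++
      lexSeqs (s + 1) l

/-- `τ_{m,m+s}(α) = ∏ α ^ (f_{i_1} ⋯ f_{i_s})`, the product over the sequences
`i_1 < ⋯ < i_s` of the first `m + s - 1` positions, in lexicographic order. -/
def tau (m s : ℕ) (α : BraidGroup m) : BraidGroup (m + s) :=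
  ((lexSeqs s (List.range (m + s - 1))).map fun i => cofaces m s i α).prod

/-- `T_{m,n}(α) = τ_{m,m}(α) τ_{m,m+1}(α) ⋯ τ_{m,n}(α)`. -/
def T {m n : ℕ} (h : m ≤ n) (α : BraidGroup m) : BraidGroup n :=
  ((List.finRange (n - m + 1)).map fun s : Fin (n - m + 1) =>
    incl (show m + (s : ℕ) ≤ n by have := s.isLt; omega) (tau m s α)).prod

end BraidGroup

/-!
Generation of the groups of Cohen braids by the half twist and the stabilized Brunnian braids.

Deleting a strand is a homomorphism on the Cohen braids `𝔥ᴮ_n`: in the rule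
`d_i (β γ) = d_i β * d_{i·β} γ` the index of the second factor does not matter. Since strands can be
deleted in either order (`delete_delete`), the image lies in `𝔥ᴮ_{n-1}`, and the kernel is the group
of Brunnian braids. So generators of `𝔥ᴮ_{n-1}`, lifted along the deletion, generate `𝔥ᴮ_n` together
with generators of `Brun_n` (`le_closure_of_delete`). The half twist `Δ_n` lifts `Δ_{n-1}`
(`delete_halfTwist`), the braid `T_{m,n}(α)` lifts `T_{m,n-1}(α)` (`delete_T`), and
`T_{n,n}(α) = α`; the induction starts with `B_2`, which is generated by `Δ_2`. The same argument
with `Δ_n ^ 2` in place of `Δ_n` covers the pure Cohen braids, as `P_2` is generated by `Δ_2 ^ 2`.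

It remains to delete strands from `T_{m,n}(α)`. The coface `d^p` is the stabilization
`B_n → B_{n+1}` conjugated by the braid `σ_p ⋯ σ_{n-1}` (`coface_eq`), and from this come the
simplicial identities between cofaces and deletions on pure braids; Brunnian braids on at least
three strands are pure (`brunnian_le_pure`). Consequently, deleting the strand `a` from an iterated
coface of a Brunnian braid `α` gives `1` if the strand is one of `α`, and otherwise omits `a` from
the added positions (`del_cofaces_of_ne`, `del_cofaces_of_eq`). Omitting a common entry `a` and
renumbering the other entries preserves the lexicographic order, so for `k > m` and every strand but
the last, `τ_{m,k}(α)` becomes `τ_{m,k-1}(α)` (`delete_castSucc_tau`). The last strand is never an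
added one, so deleting it trivializes `τ_{m,k}(α)` (`delete_last_tau`). In the product `T_{m,n}(α)` exactly one
factor is lost, and what is left is `T_{m,n-1}(α)`.
-/

namespace BraidGroup

/-! ### End positions and strand deletion -/

/-- To prove a property of all braids, check it on the generators, products and inverses. -/
theorem induction_σ {n : ℕ} {P : BraidGroup n → Prop} (one : P 1)
    (gen : ∀ j, j + 1 < n → P (σ n j)) (mul : ∀ β γ, P β → P γ → P (β * γ))
    (inv : ∀ β, P β → P β⁻¹) (β : BraidGroup n) : P β := by
  have hβ : β ∈ Subgroup.closure (Set.range (PresentedGroup.of (rels := braidRels n))) := by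
    rw [PresentedGroup.closure_range_of]; trivial
  induction hβ using Subgroup.closure_induction with
  | one => exact one
  | mem x hx =>
    obtain ⟨j, rfl⟩ := hx
    have hj : (j : ℕ) + 1 < n := by omega
    have h := gen j hj
    simpa [σ, hj] using h
  | mul x y _ _ hx hy => exact mul x y hx hy
  | inv x _ hx => exact inv x hx

theorem hom_ext_σ {n : ℕ} {G : Type*} [Group G] {f g : BraidGroup n →* G}
    (h : ∀ j, j + 1 < n → f (σ n j) = g (σ n j)) (β : BraidGroup n) : f β = g β := by
  induction β using induction_σ with
  | one => simp
  | gen j hj => exact h j hj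
  | mul β γ hβ hγ => simp [hβ, hγ]
  | inv β hβ => simp [hβ]

/-- The end position of the strand of `β` that starts in position `i`. -/
def endPos {n : ℕ} (β : BraidGroup n) (i : Fin n) : Fin n := (perm n β)⁻¹ i

theorem endPos_one {n : ℕ} (i : Fin n) : endPos (1 : BraidGroup n) i = i := by simp [endPos]

theorem endPos_mul {n : ℕ} (β γ : BraidGroup n) (i : Fin n) :
    endPos (β * γ) i = endPos γ (endPos β i) := by
  simp [endPos]

theorem endPos_injective {n : ℕ} (β : BraidGroup n) : Function.Injective (endPos β) :=
  (perm n β)⁻¹.injective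

theorem endPos_endPos_inv {n : ℕ} (β : BraidGroup n) (i : Fin n) :
    endPos β (endPos β⁻¹ i) = i := by
  rw [← endPos_mul, inv_mul_cancel, endPos_one]

theorem endPos_inv_endPos {n : ℕ} (β : BraidGroup n) (i : Fin n) :
    endPos β⁻¹ (endPos β i) = i := by
  rw [← endPos_mul, mul_inv_cancel, endPos_one]

theorem endPos_σ_val (n j : ℕ) (h : j + 1 < n) (x : Fin n) :
    (endPos (σ n j) x : ℕ) = if (x : ℕ) = j then j + 1 else if (x : ℕ) = j + 1 then j else x := by
  rw [endPos, perm, lift_σ n _ _ _ j h, adjSwap_inv, adjSwap_val n j h]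

theorem mem_pure_iff {n : ℕ} {β : BraidGroup n} : β ∈ pure n ↔ ∀ i, endPos β i = i := by
  rw [pure, MonoidHom.mem_ker, ← inv_eq_one, Equiv.ext_iff]
  rfl

/-- `del` with its values in `B_n` instead of `B_{n+1-1}`. -/
def delete {n : ℕ} (i : Fin (n + 1)) (β : BraidGroup (n + 1)) : BraidGroup n := del i β

theorem delete_one {n : ℕ} (i : Fin (n + 1)) : delete i 1 = 1 := del_one i

theorem delete_mul {n : ℕ} (i : Fin (n + 1)) (β γ : BraidGroup (n + 1)) :
    delete i (β * γ) = delete i β * delete (endPos β i) γ :=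
  del_mul i β γ

theorem delete_inv {n : ℕ} (i : Fin (n + 1)) (β : BraidGroup (n + 1)) :
    delete i β⁻¹ = (delete (endPos β⁻¹ i) β)⁻¹ := by
  refine (del_inv i β).trans ?_
  simp [endPos, delete]

theorem delete_σ {n k : ℕ} (hk : k + 1 < n + 1) (i : Fin (n + 1)) :
    delete i (σ (n + 1) k) =
      if (i : ℕ) < k then σ n (k - 1) else if k + 1 < (i : ℕ) then σ n k else 1 :=
  del_σ (n + 1) k hk i

theorem succAbove_val {n : ℕ} (i : Fin (n + 1)) (j : Fin n) :
    (i.succAbove j : ℕ) = if (j : ℕ) < i then (j : ℕ) else j + 1 := by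
  rw [Fin.succAbove]
  split_ifs with h1 h2 h2 <;> simp_all [Fin.lt_def]

/-- Deleting a strand does not disturb the endpoints of the other strands, up to the order
preserving renumbering of positions. -/
theorem endPos_succAbove {n : ℕ} (β : BraidGroup (n + 1)) (i : Fin (n + 1)) (j : Fin n) :
    endPos β (i.succAbove j) = (endPos β i).succAbove (endPos (delete i β) j) := by
  induction β using induction_σ generalizing i j with
  | one => rw [delete_one, endPos_one, endPos_one, endPos_one]
  | gen k hk =>
    apply Fin.ext
    rw [succAbove_val, endPos_σ_val _ _ hk, succAbove_val, endPos_σ_val _ _ hk, delete_σ hk]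
    have hi := i.2
    have hj := j.2
    rcases lt_or_ge (i : ℕ) k with h | h
    · rw [if_pos h, endPos_σ_val n (k - 1) (by omega)]
      split_ifs <;> omega
    · rw [if_neg h.not_gt]
      rcases lt_or_ge (k + 1) (i : ℕ) with h' | h'
      · rw [if_pos h', endPos_σ_val n k (by omega)]
        split_ifs <;> omega
      · rw [if_neg h'.not_gt, endPos_one]
        split_ifs <;> omega
  | mul β γ hβ hγ => rw [endPos_mul, hβ, hγ, endPos_mul, delete_mul, endPos_mul]
  | inv β hβ =>
    apply endPos_injective β
    rw [endPos_endPos_inv, hβ, endPos_endPos_inv, delete_inv, endPos_endPos_inv]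

/-- Two strands can be deleted in either order. The strands with starting positions `i` and `a`
are deleted; `j` is the position of `a` once `i` is deleted, and `b` that of `i` once `a` is. -/
theorem delete_delete {n : ℕ} (β : BraidGroup (n + 2)) {i a : Fin (n + 2)} {j b : Fin (n + 1)}
    (ha : i.succAbove j = a) (hi : a.succAbove b = i) :
    delete j (delete i β) = delete b (delete a β) := by
  induction β using induction_σ generalizing i a j b with
  | one => simp only [delete_one]
  | gen k hk =>
    have ha' := congrArg Fin.val ha
    have hi' := congrArg Fin.val hi
    rw [succAbove_val] at ha' hi'
    have key : ∀ (x : Fin (n + 2)) (y : Fin (n + 1)), delete y (delete x (σ (n + 2) k)) =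
        if (x : ℕ) < k then
          if (y : ℕ) < k - 1 then σ n (k - 1 - 1)
          else if k - 1 + 1 < (y : ℕ) then σ n (k - 1) else 1
        else if k + 1 < (x : ℕ) then
          if (y : ℕ) < k then σ n (k - 1) else if k + 1 < (y : ℕ) then σ n k else 1
        else 1 := by
      intro x y
      have := x.2
      rw [delete_σ hk]
      rcases lt_or_ge (x : ℕ) k with h | h
      · rw [if_pos h, if_pos h, delete_σ (by omega)]
      · rw [if_neg h.not_gt, if_neg h.not_gt]
        rcases lt_or_ge (k + 1) (x : ℕ) with h' | h'
        · rw [if_pos h', if_pos h', delete_σ (by omega)]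
        · rw [if_neg h'.not_gt, if_neg h'.not_gt, delete_one]
    rw [key, key]
    clear key
    split_ifs at * <;> first | rfl | omega
  | mul β γ hβ hγ =>
    rw [delete_mul, delete_mul, delete_mul, delete_mul, hβ ha hi]
    congr 1
    exact hγ (by rw [← ha, endPos_succAbove]) (by rw [← hi, endPos_succAbove])
  | inv β hβ =>
    rw [delete_inv, delete_inv, delete_inv, delete_inv]
    congr 1
    refine hβ ?_ ?_
    · rw [← ha, endPos_succAbove, delete_inv]
    · rw [← hi, endPos_succAbove, delete_inv]

/-! ### Stabilization -/

theorem incl_σ {k n j : ℕ} (h : k ≤ n) (hj : j + 1 < k) : incl h (σ k j) = σ n j :=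
  lift_σ k _ _ _ j hj

theorem incl_self {n : ℕ} (β : BraidGroup n) : incl le_rfl β = β :=
  hom_ext_σ (g := MonoidHom.id _) (fun _ hj => incl_σ _ hj) β

theorem incl_incl {k m n : ℕ} (h : k ≤ m) (h' : m ≤ n) (β : BraidGroup k) :
    incl h' (incl h β) = incl (h.trans h') β :=
  hom_ext_σ (f := (incl h').comp (incl h)) (fun j hj => by
    rw [MonoidHom.comp_apply, incl_σ _ hj, incl_σ _ hj, incl_σ _ (by omega)]) β

theorem endPos_incl_castLE {k n : ℕ} (h : k ≤ n) (β : BraidGroup k) (i : Fin k) :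
    endPos (incl h β) (i.castLE h) = (endPos β i).castLE h := by
  induction β using induction_σ generalizing i with
  | one => rw [map_one, endPos_one, endPos_one]
  | gen j hj =>
    apply Fin.ext
    rw [incl_σ _ hj, endPos_σ_val _ _ (by omega), Fin.val_castLE, Fin.val_castLE,
      endPos_σ_val _ _ hj]
  | mul β γ hβ hγ => rw [map_mul, endPos_mul, hβ, hγ, endPos_mul]
  | inv β hβ =>
    apply endPos_injective (incl h β)
    rw [map_inv, endPos_endPos_inv, hβ, endPos_endPos_inv]

theorem endPos_incl_of_le {k n : ℕ} (h : k ≤ n) (β : BraidGroup k) (i : Fin n)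
    (hi : k ≤ (i : ℕ)) : endPos (incl h β) i = i := by
  induction β using induction_σ with
  | one => rw [map_one, endPos_one]
  | gen j hj =>
    apply Fin.ext
    rw [incl_σ _ hj, endPos_σ_val _ _ (by omega), if_neg (by omega), if_neg (by omega)]
  | mul β γ hβ hγ => rw [map_mul, endPos_mul, hβ, hγ]
  | inv β hβ =>
    apply endPos_injective (incl h β)
    rw [map_inv, endPos_endPos_inv, hβ]

theorem incl_mem_pure {k n : ℕ} (h : k ≤ n) {β : BraidGroup k} (hβ : β ∈ pure k) :
    incl h β ∈ pure n := by
  rw [mem_pure_iff] at hβ ⊢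
  intro i
  rcases lt_or_ge (i : ℕ) k with hi | hi
  · have := endPos_incl_castLE h β ⟨i, hi⟩
    rwa [hβ] at this
  · exact endPos_incl_of_le h β i hi

theorem delete_incl_castLE {k n : ℕ} (h : k + 1 ≤ n + 1) (β : BraidGroup (k + 1))
    (i : Fin (k + 1)) :
    delete (i.castLE h) (incl h β) = incl (Nat.le_of_succ_le_succ h) (delete i β) := by
  induction β using induction_σ generalizing i with
  | one => simp only [map_one, delete_one]
  | gen j hj =>
    rw [incl_σ _ hj, delete_σ (by omega), delete_σ hj, Fin.val_castLE]
    have := i.2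
    split_ifs
    · rw [incl_σ _ (by omega)]
    · rw [incl_σ _ (by omega)]
    · rw [map_one]
  | mul β γ hβ hγ => rw [map_mul, delete_mul, hβ, endPos_incl_castLE, hγ, delete_mul, map_mul]
  | inv β hβ => rw [map_inv, delete_inv, ← map_inv, endPos_incl_castLE, hβ, delete_inv, map_inv]

theorem delete_incl_of_le {k n : ℕ} (h : k ≤ n) (β : BraidGroup k) (i : Fin (n + 1))
    (hi : k ≤ (i : ℕ)) : delete i (incl (h.trans n.le_succ) β) = incl h β := by
  induction β using induction_σ with
  | one => simp only [map_one, delete_one]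
  | gen j hj =>
    rw [incl_σ _ hj, incl_σ _ hj, delete_σ (by omega), if_neg (by omega)]
    rcases lt_or_ge (j + 1) (i : ℕ) with h' | h'
    · rw [if_pos h']
    · omega
  | mul β γ hβ hγ => rw [map_mul, delete_mul, hβ, endPos_incl_of_le _ _ _ hi, hγ, map_mul]
  | inv β hβ =>
    rw [map_inv, delete_inv, ← map_inv, endPos_incl_of_le _ _ _ hi, hβ, map_inv]

/-! ### Runs of generators -/

/-- The braid `σ_p σ_{p+1} ⋯ σ_{p+d-1}`, which moves the strand in position `p` to position
`p + d` across the `d` strands in between. -/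
def run (n p : ℕ) : ℕ → BraidGroup n
  | 0 => 1
  | d + 1 => run n p d * σ n (p + d)

theorem endPos_run_val (n p d : ℕ) (h : p + d < n) (i : Fin n) :
    (endPos (run n p d) i : ℕ) =
      if (i : ℕ) = p then p + d else if p < (i : ℕ) ∧ (i : ℕ) ≤ p + d then i - 1 else i := by
  induction d with
  | zero => rw [run, endPos_one]; split_ifs <;> omega
  | succ d ih =>
    rw [run, endPos_mul, endPos_σ_val _ _ (by omega), ih (by omega)]
    split_ifs <;> omega

/-- Deleting the moving strand of a run leaves the trivial braid, and deleting one that it crosses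
leaves a shorter run. -/
theorem delete_run (n p d : ℕ) (h : p + d < n + 1) (i : Fin (n + 1)) :
    delete i (run (n + 1) p d) =
      if (i : ℕ) < p then run n (p - 1) d
      else if (i : ℕ) = p then 1
      else if (i : ℕ) ≤ p + d then run n p (d - 1)
      else run n p d := by
  induction d with
  | zero =>
    simp only [run, delete_one, Nat.zero_sub, ite_self]
  | succ d ih =>
    rw [run, delete_mul, delete_σ (by omega), endPos_run_val _ _ _ (by omega), ih (by omega)]
    have hi : (i : ℕ) < p ∨ (i : ℕ) = p ∨ (p < i ∧ (i : ℕ) ≤ p + d) ∨ (i : ℕ) = p + d + 1 ∨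
      p + d + 1 < (i : ℕ) := by omega
    rcases hi with hi | hi | hi | hi | hi
    · simp [hi, hi.ne, show ¬ p < (i : ℕ) by omega, show (i : ℕ) < p + d by omega, run,
        show p - 1 + d = p + d - 1 by omega]
    · simp [hi]
    · obtain ⟨e, rfl⟩ : ∃ e, d = e + 1 := ⟨d - 1, by omega⟩
      simp [hi.1.not_gt, hi.1.ne', hi.1, hi.2, show (i : ℕ) - 1 < p + (e + 1) by omega,
        show (i : ℕ) ≤ p + (e + 1 + 1) by omega, run]
    · simp [hi, Nat.add_assoc]
    · simp [show ¬ (i : ℕ) < p by omega, show (i : ℕ) ≠ p by omega,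
        show ¬ (i : ℕ) ≤ p + d by omega, show ¬ (i : ℕ) < p + d by omega, hi,
        show ¬ (i : ℕ) ≤ p + (d + 1) by omega, run]

theorem run_mul_σ_of_add_lt {n p d j : ℕ} (h : p + d < j) :
    run n p d * σ n j = σ n j * run n p d := by
  induction d with
  | zero => simp [run]
  | succ d ih =>
    rw [run, mul_assoc, σ_comm n (p + d) j (by omega), ← mul_assoc, ih (by omega), mul_assoc]

theorem run_mul_σ_of_lt {n p d j : ℕ} (h : j + 1 < p) :
    run n p d * σ n j = σ n j * run n p d := by
  induction d with
  | zero => simp [run]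
  | succ d ih =>
    rw [run, mul_assoc, ← σ_comm n j (p + d) (by omega), ← mul_assoc, ih, mul_assoc]

/-- Conjugation by a run shifts the generators inside it by one. -/
theorem run_mul_σ {n p d j : ℕ} (hp : p ≤ j) (hj : j + 1 < p + d) (hn : p + d < n) :
    run n p d * σ n j = σ n (j + 1) * run n p d := by
  induction d with
  | zero => omega
  | succ d ih =>
    rcases lt_or_ge (j + 1) (p + d) with h | h
    · rw [run, mul_assoc, ← σ_comm n j (p + d) h, ← mul_assoc, ih h (by omega), mul_assoc]
    · obtain ⟨e, rfl⟩ : ∃ e, d = e + 1 := ⟨d - 1, by omega⟩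
      obtain rfl : j = p + e := by omega
      have hb := σ_braid n (p + e) (by omega)
      have hc := run_mul_σ_of_add_lt (n := n) (show p + e < p + e + 1 by omega)
      rw [run, run, show p + (e + 1) = p + e + 1 by omega, mul_assoc, mul_assoc,
        ← mul_assoc (σ n (p + e)), hb, mul_assoc (σ n (p + e + 1)), ← mul_assoc, hc, mul_assoc,
        mul_assoc]

theorem run_succ' (n p d : ℕ) : run n p (d + 1) = σ n p * run n (p + 1) d := by
  induction d with
  | zero => simp [run]
  | succ d ih => rw [run, ih, mul_assoc, run, show p + (d + 1) = p + 1 + d by omega]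

/-! ### Cofaces -/

/-- Adding a trivial strand in position `p` is adding one in the last position, conjugated by the
braid that carries position `p` there. -/
theorem coface_eq {n p : ℕ} (hp : p ≤ n) (β : BraidGroup n) :
    coface n p β = run (n + 1) p (n - p) * incl n.le_succ β * (run (n + 1) p (n - p))⁻¹ := by
  refine hom_ext_σ (f := coface n p)
    (g := (MulAut.conj (run (n + 1) p (n - p))).toMonoidHom.comp (incl n.le_succ))
    (fun j hj => ?_) β
  simp only [MonoidHom.comp_apply, MulEquiv.toMonoidHom_eq_coe, MonoidHom.coe_coe,
    MulAut.conj_apply]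
  rw [incl_σ _ hj, coface_σ _ _ _ hj, cofaceGen]
  split_ifs with h1 h2
  · rw [run_mul_σ_of_lt h1, mul_inv_cancel_right]
  -- Only the first factor `σ_p` of the run fails to commute with `σ_{p-1}`.
  · obtain ⟨d, hd⟩ : ∃ d, n - p = d + 1 := ⟨n - p - 1, by omega⟩
    rw [hd, run_succ', mul_assoc (σ (n + 1) p) (run _ _ _), run_mul_σ_of_lt (by omega), mul_inv_rev]
    group
  · rw [run_mul_σ (by omega) (by omega) (by omega), mul_inv_cancel_right]

theorem coface_mem_pure {n p : ℕ} (hp : p ≤ n) {β : BraidGroup n} (hβ : β ∈ pure n) :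
    coface n p β ∈ pure (n + 1) := by
  rw [coface_eq hp]
  have : (pure (n + 1)).Normal := MonoidHom.normal_ker _
  exact this.conj_mem _ (incl_mem_pure _ hβ) _

/-- Deleting a strand from a conjugate of a pure braid. -/
theorem delete_conj {n : ℕ} (i : Fin (n + 1)) (c : BraidGroup (n + 1)) {β : BraidGroup (n + 1)}
    (hβ : β ∈ pure (n + 1)) :
    delete i (c * β * c⁻¹) = delete i c * delete (endPos c i) β * (delete i c)⁻¹ := by
  rw [delete_mul, delete_mul, delete_inv, endPos_mul, mem_pure_iff.mp hβ, endPos_inv_endPos]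

/-- Deleting the strand that was just added. It is carried to the last position and back, and the
conjugating braid becomes trivial once it is deleted. -/
theorem delete_coface_self {n p : ℕ} {β : BraidGroup n} (hβ : β ∈ pure n) (i : Fin (n + 1))
    (hi : (i : ℕ) = p) : delete i (coface n p β) = β := by
  have := i.2
  rw [coface_eq (by omega), delete_conj _ _ (incl_mem_pure _ hβ), delete_run _ _ _ (by omega),
    if_neg (by omega), if_pos hi, one_mul, inv_one, mul_one, delete_incl_of_le le_rfl, incl_self]
  rw [endPos_run_val _ _ _ (by omega), if_pos hi]
  omega

theorem delete_coface_of_lt {n p : ℕ} (hp : p ≤ n + 1) {β : BraidGroup (n + 1)}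
    (hβ : β ∈ pure (n + 1)) (i : Fin (n + 2)) (j : Fin (n + 1)) (hij : (i : ℕ) = j)
    (hi : (i : ℕ) < p) : delete i (coface (n + 1) p β) = coface n (p - 1) (delete j β) := by
  rw [coface_eq hp, delete_conj _ _ (incl_mem_pure _ hβ), delete_run _ _ _ (by omega), if_pos hi,
    coface_eq (by omega), show n - (p - 1) = n + 1 - p by omega]
  have he : endPos (run (n + 1 + 1) p (n + 1 - p)) i = j.castLE (n + 1).le_succ := by
    apply Fin.ext
    rw [endPos_run_val _ _ _ (by omega), if_neg hi.ne, if_neg (by omega), hij, Fin.val_castLE]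
  rw [he, delete_incl_castLE]

theorem delete_coface_of_gt {n p : ℕ} {β : BraidGroup (n + 1)}
    (hβ : β ∈ pure (n + 1)) (i : Fin (n + 2)) (j : Fin (n + 1)) (hij : (i : ℕ) = j + 1)
    (hi : p < (i : ℕ)) : delete i (coface (n + 1) p β) = coface n p (delete j β) := by
  have := i.2
  rw [coface_eq (by omega), delete_conj _ _ (incl_mem_pure _ hβ), delete_run _ _ _ (by omega),
    if_neg (by omega), if_neg (by omega), if_pos (by omega),
    coface_eq (by omega), show n + 1 - p - 1 = n - p by omega]
  have he : endPos (run (n + 1 + 1) p (n + 1 - p)) i = j.castLE (n + 1).le_succ := by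
    apply Fin.ext
    rw [endPos_run_val _ _ _ (by omega), if_neg hi.ne', if_pos (by omega), hij, Fin.val_castLE]
    omega
  rw [he, delete_incl_castLE]

/-! ### Brunnian braids and their cofaces -/

theorem delete_eq_one {n : ℕ} {β : BraidGroup (n + 1)} (hβ : β ∈ brunnian (n + 1))
    (i : Fin (n + 1)) : delete i β = 1 := hβ i

/-- Once one strand of a Brunnian braid on at least three strands is deleted, the endpoints of the
other strands are in their original order; applying this to all pairs, the braid is pure. -/
theorem brunnian_le_pure {n : ℕ} (hn : 3 ≤ n) : brunnian n ≤ pure n := by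
  obtain ⟨n, rfl⟩ : ∃ k, n = k + 1 := ⟨n - 1, by omega⟩
  intro β hβ
  have mono : ∀ a b : Fin (n + 1), a < b → endPos β a < endPos β b := by
    intro a b hab
    obtain ⟨c, hca, hcb⟩ : ∃ c : Fin (n + 1), c ≠ a ∧ c ≠ b := by
      by_contra! h
      have h0 := h ⟨0, by omega⟩
      have h1 := h ⟨1, by omega⟩
      have h2 := h ⟨2, by omega⟩
      simp only [ne_eq, Fin.ext_iff] at h0 h1 h2
      omega
    obtain ⟨x, rfl⟩ := Fin.exists_succAbove_eq hca.symm
    obtain ⟨y, rfl⟩ := Fin.exists_succAbove_eq hcb.symm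
    rw [endPos_succAbove, endPos_succAbove, delete_eq_one hβ, endPos_one, endPos_one]
    exact Fin.strictMono_succAbove _ (Fin.strictMono_succAbove c |>.lt_iff_lt.mp hab)
  have hm : StrictMono (endPos β) := fun a b => mono a b
  have hb : Function.Bijective (endPos β) := (perm (n + 1) β)⁻¹.bijective
  rw [mem_pure_iff]
  -- The identity is the only order automorphism of `Fin (n + 1)`.
  have := Subsingleton.elim
    (StrictMono.orderIsoOfSurjective (endPos β) hm hb.2) (OrderIso.refl (Fin (n + 1)))
  exact fun i => DFunLike.congr_fun this i

theorem cofaces_mem_pure {m s : ℕ} {i : Fin s → ℕ} (hi : ∀ r, i r ≤ m + r) {α : BraidGroup m}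
    (hα : α ∈ pure m) : cofaces m s i α ∈ pure (m + s) := by
  induction s with
  | zero => exact hα
  | succ s ih => exact coface_mem_pure (hi (Fin.last s)) (ih fun r => hi r.castSucc)

/-- If the strand `i` of a coface of `β` comes from the strand `j` of `β`, and deleting `j`
trivializes `β`, then deleting `i` trivializes the coface. -/
theorem delete_coface_eq_one {n p : ℕ} (hp : p ≤ n) {β : BraidGroup n} (hβ : β ∈ pure n)
    (i : Fin (n + 1)) (hi : (i : ℕ) ≠ p)
    (h : ∀ j : Fin n, (i : ℕ) < p ∧ (j : ℕ) = i ∨ p < (i : ℕ) ∧ (j : ℕ) + 1 = i → del j β = 1) :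
    delete i (coface n p β) = 1 := by
  have := i.2
  obtain ⟨n, rfl⟩ : ∃ k, n = k + 1 := ⟨n - 1, by omega⟩
  rcases lt_or_gt_of_ne hi with hip | hip
  · rw [delete_coface_of_lt hp hβ i ⟨i, by omega⟩ rfl hip, delete, h _ (Or.inl ⟨hip, rfl⟩), map_one]
  · have hj : (i : ℕ) = (⟨i - 1, by omega⟩ : Fin (n + 1)) + 1 := by simp only; omega
    rw [delete_coface_of_gt hβ i ⟨i - 1, by omega⟩ hj hip, delete, h _ (Or.inr ⟨hip, hj.symm⟩),
      map_one]

/-- Deleting from an iterated coface of a Brunnian braid a strand that was not added later leaves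
the trivial braid. -/
theorem del_cofaces_of_ne {m s : ℕ} {i : Fin s → ℕ} (hi : ∀ r, i r ≤ m + r) (hm : StrictMono i)
    {α : BraidGroup m} (hα : α ∈ brunnian m) (hp : α ∈ pure m) (a : Fin (m + s))
    (ha : ∀ r, i r ≠ a) : del a (cofaces m s i α) = 1 := by
  induction s with
  | zero => exact hα a
  | succ s ih =>
    have hi' : ∀ r : Fin s, Fin.init i r ≤ m + r := fun r => hi r.castSucc
    have hm' : StrictMono (Fin.init i) := fun r t h => hm (Fin.castSucc_lt_castSucc_iff.mpr h)
    refine delete_coface_eq_one (hi (Fin.last s)) (cofaces_mem_pure hi' hp) a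
      (ha (Fin.last s)).symm fun j hj => ih hi' hm' j fun r => ?_
    have hlt : i r.castSucc < i (Fin.last s) := hm (Fin.castSucc_lt_last r)
    have hne := ha r.castSucc
    rw [Fin.init]
    omega

/-- The renumbering of the positions other than `a` after position `a` is removed. -/
def dropPos (a v : ℕ) : ℕ := if v ≤ a then v else v - 1

/-- Deleting from an iterated coface a strand that was added undoes that addition. -/
theorem del_cofaces_of_eq {m s : ℕ} {i : Fin (s + 1) → ℕ} (hi : ∀ r, i r ≤ m + r)
    (hm : StrictMono i) {α : BraidGroup m} (hp : α ∈ pure m) (a : Fin (m + (s + 1)))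
    (r : Fin (s + 1)) (ha : i r = a) :
    del a (cofaces m (s + 1) i α) = cofaces m s (fun t => dropPos a (i (r.succAbove t))) α := by
  have hi' : ∀ r : Fin s, Fin.init i r ≤ m + r := fun r => hi r.castSucc
  have hm' : StrictMono (Fin.init i) := fun r t h => hm (Fin.castSucc_lt_castSucc_iff.mpr h)
  induction r using Fin.lastCases with
  | last =>
    refine (delete_coface_self (cofaces_mem_pure hi' hp) a ha.symm).trans ?_
    congr 2
    funext t
    have hlt : i t.castSucc < i (Fin.last s) := hm (Fin.castSucc_lt_last t)
    rw [Fin.succAbove_last, dropPos, if_pos (by omega), Fin.init]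
  | cast r =>
    cases s with
    | zero => exact r.elim0
    | succ s =>
      have hlt : i r.castSucc < i (Fin.last (s + 1)) := hm (Fin.castSucc_lt_last r)
      have hle : i r.castSucc ≤ m + r := hi r.castSucc
      have hr := r.2
      have ih := del_cofaces_of_eq hi' hm' hp ⟨a, by omega⟩ r ha
      refine (delete_coface_of_lt (n := m + s) (hi (Fin.last (s + 1)))
        (cofaces_mem_pure hi' hp) a ⟨a, by omega⟩ rfl (by omega)).trans ?_
      refine (congrArg (coface (m + s) _) ih).trans ?_
      have hl : r.castSucc.succAbove (Fin.last s) = Fin.last (s + 1) :=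
        Fin.succAbove_castSucc_of_le _ _ (Fin.le_last _)
      rw [cofaces, MonoidHom.comp_apply, hl, dropPos, if_neg (by omega)]
      congr 3
      funext t
      rw [Fin.init, Fin.init, ← Fin.castSucc_succAbove_castSucc]

/-! ### The products `τ` and `T` -/

/-- The sequences are taken by place in the list, so relabelling its entries keeps their order. -/
theorem lexSeqs_map (f : ℕ → ℕ) (s : ℕ) (l : List ℕ) :
    lexSeqs s (l.map f) = (lexSeqs s l).map fun i t => f (i t) := by
  induction l generalizing s with
  | nil =>
    cases s with
    | zero => simp only [lexSeqs, List.map_cons, List.map_nil]; congr 1; exact Subsingleton.elim _ _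
    | succ s => rfl
  | cons a l ih =>
    cases s with
    | zero => simp only [lexSeqs, List.map_cons, List.map_nil]; congr 1; exact Subsingleton.elim _ _
    | succ s =>
      simp only [List.map_cons, lexSeqs, ih, List.map_append, List.map_map]
      congr 1
      refine List.map_congr_left fun i _ => ?_
      funext t
      cases t using Fin.cases <;> rfl

theorem mem_of_mem_lexSeqs {s : ℕ} {l : List ℕ} {i : Fin s → ℕ} (h : i ∈ lexSeqs s l)
    (r : Fin s) : i r ∈ l := by
  induction l generalizing s with
  | nil =>
    cases s with
    | zero => exact r.elim0
    | succ s => simp [lexSeqs] at h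
  | cons a l ih =>
    cases s with
    | zero => exact r.elim0
    | succ s =>
      simp only [lexSeqs, List.mem_append, List.mem_map] at h
      rcases h with ⟨i, h, rfl⟩ | h
      · cases r using Fin.cases with
        | zero => simp
        | succ r => exact List.mem_cons_of_mem _ (by simpa using ih h r)
      · exact List.mem_cons_of_mem _ (ih h r)

theorem strictMono_of_mem_lexSeqs {s : ℕ} {l : List ℕ} (hl : l.Pairwise (· < ·)) {i : Fin s → ℕ}
    (h : i ∈ lexSeqs s l) : StrictMono i := by
  induction l generalizing s with
  | nil =>
    cases s with
    | zero => exact fun r => r.elim0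
    | succ s => simp [lexSeqs] at h
  | cons a l ih =>
    cases s with
    | zero => exact fun r => r.elim0
    | succ s =>
      rw [List.pairwise_cons] at hl
      simp only [lexSeqs, List.mem_append, List.mem_map] at h
      rcases h with ⟨i, h, rfl⟩ | h
      · intro x y hxy
        cases y using Fin.cases with
        | zero => exact absurd hxy (Fin.not_lt_zero x)
        | succ y =>
          cases x using Fin.cases with
          | zero => exact hl.1 _ (mem_of_mem_lexSeqs h y)
          | succ x => exact ih hl.2 h (Fin.succ_lt_succ_iff.mp hxy)
      · exact ih hl.2 h

/-- In a lexicographically ordered product over sequences, suppose that the factors of the sequences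
without the entry `a` are trivial, and that the factor of every other sequence depends only on
the renumbered sequence with `a` dropped. Then it is the lexicographically ordered product over
the shorter renumbered sequences: dropping `a` preserves the order. -/
theorem prod_lexSeqs_drop {G : Type*} [Monoid G] (a s : ℕ) (l₁ l₂ : List ℕ)
    (h₁ : ∀ v ∈ l₁, v < a) (h₂ : ∀ v ∈ l₂, a < v) (F : (Fin (s + 1) → ℕ) → G)
    (F' : (Fin s → ℕ) → G)
    (hne : ∀ i ∈ lexSeqs (s + 1) (l₁ ++ a :: l₂), (∀ r, i r ≠ a) → F i = 1)
    (heq : ∀ i ∈ lexSeqs (s + 1) (l₁ ++ a :: l₂), ∀ r, i r = a →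
      F i = F' fun t => dropPos a (i (r.succAbove t))) :
    ((lexSeqs (s + 1) (l₁ ++ a :: l₂)).map F).prod =
      ((lexSeqs s ((l₁ ++ l₂).map (dropPos a))).map F').prod := by
  induction l₁ generalizing s with
  | nil =>
    simp only [List.nil_append, lexSeqs, List.map_append, List.prod_append, List.map_map,
      List.mem_append, List.mem_map] at *
    have h1 : ((lexSeqs (s + 1) l₂).map F).prod = 1 := by
      refine List.prod_eq_one fun x hx => ?_
      obtain ⟨i, hi, rfl⟩ := List.mem_map.mp hx
      exact hne i (Or.inr hi) fun r => (h₂ _ (mem_of_mem_lexSeqs hi r)).ne'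
    rw [h1, mul_one, lexSeqs_map, List.map_map]
    congr 1
    refine List.map_congr_left fun i hi => ?_
    exact heq _ (Or.inl ⟨i, hi, rfl⟩) 0 rfl
  | cons b l₁ ih =>
    have hb : b < a := h₁ b (by simp)
    have hl₁ : ∀ v ∈ l₁, v < a := fun v hv => h₁ v (List.mem_cons_of_mem _ hv)
    have hdb : dropPos a b = b := if_pos hb.le
    simp only [List.cons_append, lexSeqs, List.mem_append, List.mem_map] at hne heq
    have tail := ih s hl₁ F F' (fun i hi => hne i (Or.inr hi)) (fun i hi => heq i (Or.inr hi))
    rw [List.cons_append, lexSeqs, List.map_append, List.prod_append, tail, List.cons_append,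
      List.map_cons, hdb, List.map_map]
    cases s with
    | zero =>
      have h1 : F (Fin.cons b Fin.elim0) = 1 := by
        refine hne _ (Or.inl ⟨Fin.elim0, by simp [lexSeqs], rfl⟩) fun r => ?_
        rw [Fin.fin_one_eq_zero r]
        exact hb.ne
      simp only [lexSeqs, List.map_cons, List.map_nil, Function.comp_apply]
      rw [h1]
      simp
    | succ s =>
      rw [lexSeqs, List.map_append (f := F'), List.prod_append, List.map_map]
      congr 1
      refine ih s hl₁ _ _ (fun i hi hr => ?_) (fun i hi r hr => ?_)
      · refine hne _ (Or.inl ⟨i, hi, rfl⟩) fun r => ?_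
        cases r using Fin.cases with
        | zero => exact hb.ne
        | succ r => exact hr r
      · rw [Function.comp_apply, heq _ (Or.inl ⟨i, hi, rfl⟩) r.succ hr, Function.comp_apply]
        congr 1
        funext t
        cases t using Fin.cases with
        | zero => exact hdb
        | succ t => rw [Fin.succ_succAbove_succ]; rfl

theorem add_le_of_strictMono {s : ℕ} {i : Fin s → ℕ} (hm : StrictMono i) (r : Fin s) (d : ℕ)
    (h : r + d < s) : i r + d ≤ i ⟨r + d, h⟩ := by
  induction d with
  | zero => exact le_rfl
  | succ d ih =>
    have h1 := ih (by omega)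
    have h2 : i ⟨r + d, by omega⟩ < i ⟨r + (d + 1), h⟩ := hm (by simp [Fin.lt_def])
    omega

/-- The sequences that index `τ` are increasing, and each entry is a position at which a strand can
be added. -/
theorem strictMono_and_le_of_mem_lexSeqs_range {m s : ℕ} {i : Fin s → ℕ}
    (h : i ∈ lexSeqs s (List.range (m + s - 1))) : StrictMono i ∧ ∀ r, i r ≤ m + r := by
  have hm := strictMono_of_mem_lexSeqs List.pairwise_lt_range h
  refine ⟨hm, fun r => ?_⟩
  have hr := r.2
  have h1 := add_le_of_strictMono hm r (s - 1 - r) (by omega)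
  have h2 := List.mem_range.mp (mem_of_mem_lexSeqs h ⟨r + (s - 1 - r), by omega⟩)
  omega

theorem tau_mem_pure {m s : ℕ} {α : BraidGroup m} (hα : α ∈ pure m) :
    tau m s α ∈ pure (m + s) := by
  refine Subgroup.list_prod_mem _ fun x hx => ?_
  obtain ⟨i, hi, rfl⟩ := List.mem_map.mp hx
  exact cofaces_mem_pure (strictMono_and_le_of_mem_lexSeqs_range hi).2 hα

/-- Deletion of a strand is multiplicative on pure braids. -/
theorem delete_list_prod {n : ℕ} (a : Fin (n + 1)) (l : List (BraidGroup (n + 1)))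
    (hl : ∀ x ∈ l, x ∈ pure (n + 1)) : delete a l.prod = (l.map (delete a)).prod := by
  induction l with
  | nil => exact delete_one a
  | cons x l ih =>
    rw [List.prod_cons, delete_mul, mem_pure_iff.mp (hl x (by simp)),
      ih fun y hy => hl y (List.mem_cons_of_mem _ hy), List.map_cons, List.prod_cons]

theorem delete_tau {m s : ℕ} (a : Fin (m + s + 1)) {α : BraidGroup m} (hα : α ∈ pure m) :
    delete a (tau m (s + 1) α) =
      ((lexSeqs (s + 1) (List.range (m + s))).map fun i =>
        (del a (cofaces m (s + 1) i α) : BraidGroup (m + s))).prod := by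
  refine (delete_list_prod a _ fun x hx => ?_).trans ?_
  · obtain ⟨i, hi, rfl⟩ := List.mem_map.mp hx
    exact cofaces_mem_pure (strictMono_and_le_of_mem_lexSeqs_range hi).2 hα
  · rw [List.map_map]
    rfl

/-- No factor of `τ_{m,k}` adds a strand in the last position, so deleting the last strand
trivializes it. -/
theorem delete_last_tau {m s : ℕ} {α : BraidGroup m} (hα : α ∈ brunnian m) (hp : α ∈ pure m) :
    delete (Fin.last (m + s)) (tau m (s + 1) α) = 1 := by
  rw [delete_tau _ hp]
  refine List.prod_eq_one fun x hx => ?_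
  obtain ⟨i, hi, rfl⟩ := List.mem_map.mp hx
  obtain ⟨hm, hle⟩ := strictMono_and_le_of_mem_lexSeqs_range (m := m) (s := s + 1) hi
  exact del_cofaces_of_ne hle hm hα hp (Fin.last (m + s)) fun r =>
    (List.mem_range.mp (mem_of_mem_lexSeqs hi r)).ne

theorem range_eq_append {a N : ℕ} (h : a < N) :
    List.range N = List.range a ++ a :: List.range' (a + 1) (N - 1 - a) := by
  obtain ⟨k, rfl⟩ : ∃ k, N = a + (k + 1) := ⟨N - 1 - a, by omega⟩
  rw [show a + (k + 1) - 1 - a = k by omega, List.range_eq_range', List.range_eq_range',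
    ← List.range'_append_1, Nat.zero_add, List.range'_succ]

theorem map_dropPos_range {a N : ℕ} (h : a < N) :
    (List.range a ++ List.range' (a + 1) (N - 1 - a)).map (dropPos a) = List.range (N - 1) := by
  obtain ⟨k, rfl⟩ : ∃ k, N = a + (k + 1) := ⟨N - 1 - a, by omega⟩
  rw [show a + (k + 1) - 1 - a = k by omega, show a + (k + 1) - 1 = a + k by omega,
    List.range_eq_range', List.range_eq_range', ← List.range'_append_1, Nat.zero_add,
    List.map_append, Nat.add_comm a 1, ← List.map_add_range', List.map_map]
  congr 1
  · conv_rhs => rw [← List.map_id (List.range' 0 a)]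
    refine List.map_congr_left fun v hv => if_pos ?_
    have := List.mem_range'_1.mp hv
    omega
  · conv_rhs => rw [← List.map_id (List.range' a k)]
    refine List.map_congr_left fun v hv => ?_
    have := List.mem_range'_1.mp hv
    simp only [Function.comp_apply, dropPos, id]
    rw [if_neg (by omega)]
    omega

/-- Deleting any other strand from `τ_{m,k}` yields `τ_{m,k-1}`. -/
theorem delete_castSucc_tau {m s : ℕ} {α : BraidGroup m} (hα : α ∈ brunnian m) (hp : α ∈ pure m)
    (a : Fin (m + s)) : delete a.castSucc (tau m (s + 1) α) = tau m s α := by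
  have hr := range_eq_append a.isLt
  have hd := map_dropPos_range a.isLt
  rw [delete_tau _ hp, tau, ← hd, hr]
  refine prod_lexSeqs_drop a s _ _ (fun v hv => List.mem_range.mp hv)
    (fun v hv => (List.mem_range'_1.mp hv).1) _ _ (fun i hi hne => ?_) (fun i hi r hr' => ?_) <;>
  · rw [← hr] at hi
    obtain ⟨hm, hle⟩ := strictMono_and_le_of_mem_lexSeqs_range (m := m) (s := s + 1) hi
    first
    | exact del_cofaces_of_ne hle hm hα hp a.castSucc hne
    | exact del_cofaces_of_eq hle hm hp a.castSucc r hr'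

/-- `T_{m,m+s}` as a product over `Fin (s + 1)`, in place of `Fin (m + s - m + 1)`. -/
theorem T_eq {m s : ℕ} (h : m ≤ m + s) (α : BraidGroup m) :
    T h α = ((List.finRange (s + 1)).map fun t : Fin (s + 1) =>
      incl (Nat.add_le_add_left (Nat.le_of_lt_succ t.isLt) m) (tau m t α)).prod := by
  have key : ∀ N, (hN : N = s) → ∀ hle : ∀ t : Fin (N + 1), m + (t : ℕ) ≤ m + s,
      ((List.finRange (N + 1)).map fun t : Fin (N + 1) => incl (hle t) (tau m t α)).prod =
      ((List.finRange (s + 1)).map fun t : Fin (s + 1) =>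
        incl (Nat.add_le_add_left (Nat.le_of_lt_succ t.isLt) m) (tau m t α)).prod := by
    rintro N rfl hle
    rfl
  exact key _ (by omega) _

theorem tau_zero {m : ℕ} (α : BraidGroup m) : tau m 0 α = α := by
  simp [tau, lexSeqs, cofaces]

theorem T_self {m : ℕ} (h : m ≤ m) (α : BraidGroup m) : T h α = α := by
  refine (T_eq (s := 0) h α).trans ?_
  simp [List.finRange_succ, tau_zero, incl_self]

theorem T_succ {m s : ℕ} (α : BraidGroup m) :
    T (m.le_add_right (s + 1)) α =
      incl (Nat.le_succ (m + s)) (T (m.le_add_right s) α) * tau m (s + 1) α := by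
  rw [T_eq, T_eq, List.finRange_succ_last, List.map_append, List.prod_append, List.map_map,
    map_list_prod, List.map_map]
  congr 1
  · congr 1
    refine List.map_congr_left fun t _ => ?_
    exact (incl_incl _ _ _).symm
  · simp [incl_self]

theorem T_mem_pure {m s : ℕ} {α : BraidGroup m} (hα : α ∈ pure m) :
    T (m.le_add_right s) α ∈ pure (m + s) := by
  induction s with
  | zero => rwa [T_self]
  | succ s ih => rw [T_succ]; exact mul_mem (incl_mem_pure _ ih) (tau_mem_pure hα)

theorem delete_castSucc_incl {n : ℕ} (β : BraidGroup n) (a : Fin n) :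
    delete a.castSucc (incl n.le_succ β) = incl (n.sub_le 1) (del a β) := by
  cases n with
  | zero => exact a.elim0
  | succ n => exact delete_incl_castLE (n + 1).le_succ β a

/-- Deleting any strand from `T_{m,k}` yields `T_{m,k-1}`. -/
theorem delete_T {m s : ℕ} {α : BraidGroup m} (hα : α ∈ brunnian m) (hp : α ∈ pure m)
    (a : Fin (m + s + 1)) :
    delete a (T (m.le_add_right (s + 1)) α) = T (m.le_add_right s) α := by
  rw [T_succ, delete_mul, mem_pure_iff.mp (incl_mem_pure _ (T_mem_pure hp))]
  induction a using Fin.lastCases with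
  | last => rw [delete_last_tau hα hp, mul_one, delete_incl_of_le le_rfl _ _ le_rfl, incl_self]
  | cast a =>
    rw [delete_castSucc_tau hα hp, delete_castSucc_incl]
    cases s with
    | zero => rw [T_self, hα a, map_one, one_mul, tau_zero]
    | succ s =>
      rw [T_succ (s := s)]
      exact congrArg (fun x => incl _ x * _) ((congrArg _ (T_succ α).symm).trans (delete_T hα hp a))

theorem T_mem_cohen {m s : ℕ} {α : BraidGroup m} (hα : α ∈ brunnian m) (hp : α ∈ pure m) :
    T (m.le_add_right s) α ∈ cohen (m + s) := by
  intro i j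
  cases s with
  | zero => rw [T_self]; exact (hα i).trans (hα j).symm
  | succ s => exact (delete_T hα hp i).trans (delete_T hα hp j).symm

/-! ### The half twist -/

theorem prod_map_σ_range (n d : ℕ) : ((List.range d).map (σ n)).prod = run n 0 d := by
  induction d with
  | zero => rfl
  | succ d ih => simp [List.range_succ, ih, run]

theorem incl_run {k n d : ℕ} (h : k ≤ n) (hd : d < k) : incl h (run k 0 d) = run n 0 d := by
  induction d with
  | zero => simp [run]
  | succ d ih => rw [run, map_mul, ih (by omega), incl_σ _ (by omega), run]

/-- The half twist carries the first strand across all others, which then undergo a half twist. -/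
theorem halfTwist_succ (n : ℕ) :
    halfTwist (n + 1) = run (n + 1) 0 n * incl n.le_succ (halfTwist n) := by
  cases n with
  | zero => simp [halfTwist, run]
  | succ n =>
    simp only [halfTwist, Nat.add_sub_cancel, List.range_succ (n := n), List.reverse_append,
      List.reverse_singleton, List.singleton_append, List.map_cons, List.prod_cons,
      prod_map_σ_range, map_list_prod, List.map_map]
    congr 2
    refine List.map_congr_left fun r hr => ?_
    have := List.mem_range.mp (List.mem_reverse.mp hr)
    exact (incl_run _ (by omega)).symm

theorem delete_halfTwist {n : ℕ} (a : Fin (n + 1)) :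
    delete a (halfTwist (n + 1)) = halfTwist n := by
  induction n with
  | zero =>
    have h : halfTwist (0 + 1) = 1 := by simp [halfTwist]
    rw [h, delete_one]
    simp [halfTwist]
  | succ n ih =>
    rw [halfTwist_succ, delete_mul, delete_run _ _ _ (by omega), if_neg (Nat.not_lt_zero _)]
    cases a using Fin.cases with
    | zero =>
      rw [if_pos (Fin.val_zero _), one_mul, delete_incl_of_le le_rfl, incl_self]
      rw [endPos_run_val _ _ _ (by omega)]
      simp
    | succ a =>
      have he : endPos (run (n + 1 + 1) 0 (n + 1)) a.succ = a.castSucc := by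
        apply Fin.ext
        rw [endPos_run_val _ _ _ (by omega), Fin.val_succ, Fin.val_castSucc]
        rw [if_neg (Nat.succ_ne_zero _), if_pos (by omega), Nat.add_sub_cancel]
      rw [he, delete_castSucc_incl]
      have h1 : del a (halfTwist (n + 1)) = halfTwist n := ih a
      rw [h1, if_neg (by simp), if_pos (by rw [Fin.val_succ]; omega), halfTwist_succ]
      rfl

/-- The half twist reverses the order of the positions. -/
theorem endPos_halfTwist_val {n : ℕ} (i : Fin n) :
    (endPos (halfTwist n) i : ℕ) = n - 1 - i := by
  induction n with
  | zero => exact i.elim0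
  | succ n ih =>
    rw [halfTwist_succ, endPos_mul]
    cases i using Fin.cases with
    | zero =>
      have he : endPos (run (n + 1) 0 n) 0 = Fin.last n := by
        apply Fin.ext
        rw [endPos_run_val _ _ _ (by omega)]
        simp
      rw [he, endPos_incl_of_le _ _ (Fin.last n) le_rfl]
      simp
    | succ i =>
      have he : endPos (run (n + 1) 0 n) i.succ = i.castLE n.le_succ := by
        apply Fin.ext
        rw [endPos_run_val _ _ _ (by omega), Fin.val_succ, Fin.val_castLE]
        rw [if_neg (Nat.succ_ne_zero _), if_pos (by omega), Nat.add_sub_cancel]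
      rw [he, endPos_incl_castLE, Fin.val_castLE, ih, Fin.val_succ]
      omega

theorem halfTwist_mem_cohen (n : ℕ) : halfTwist n ∈ cohen n := by
  cases n with
  | zero => exact fun i => i.elim0
  | succ n => exact fun i j => (delete_halfTwist i).trans (delete_halfTwist j).symm

theorem halfTwist_sq_mem_pure (n : ℕ) : halfTwist n ^ 2 ∈ pure n := by
  rw [mem_pure_iff]
  intro i
  apply Fin.ext
  rw [pow_two, endPos_mul, endPos_halfTwist_val, endPos_halfTwist_val]
  omega

/-! ### Strand deletion on Cohen braids -/

theorem delete_mul_of_mem_cohen {n : ℕ} (a : Fin (n + 1)) (β : BraidGroup (n + 1))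
    {γ : BraidGroup (n + 1)} (hγ : γ ∈ cohen (n + 1)) :
    delete a (β * γ) = delete a β * delete a γ := by
  rw [delete_mul]
  exact congrArg _ (hγ _ _)

theorem delete_inv_of_mem_cohen {n : ℕ} (a : Fin (n + 1)) {β : BraidGroup (n + 1)}
    (hβ : β ∈ cohen (n + 1)) : delete a β⁻¹ = (delete a β)⁻¹ := by
  rw [delete_inv]
  exact congrArg _ (hβ _ _)

/-- The common value of the deletions of a Cohen braid is again a Cohen braid: deleting its strands
`i` and `j` amounts to deleting the same pair of strands of the original braid in the two orders. -/
theorem delete_mem_cohen {n : ℕ} (a : Fin (n + 1)) {β : BraidGroup (n + 1)}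
    (hβ : β ∈ cohen (n + 1)) : delete a β ∈ cohen n := by
  cases n with
  | zero => exact fun i => i.elim0
  | succ n =>
    -- For `i ≤ j`, the strands of `β` in question are `i` and `j + 1`.
    have key : ∀ i j : Fin (n + 1), i ≤ j → delete j (delete a β) = delete i (delete a β) := by
      intro i j hij
      have h1 : delete a β = delete i.castSucc β := hβ _ _
      have h2 : delete a β = delete j.succ β := hβ _ _
      conv_lhs => rw [h1]
      conv_rhs => rw [h2]
      exact delete_delete β (Fin.succAbove_castSucc_of_le i j hij)
        (Fin.succAbove_succ_of_le j i hij)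
    intro i j
    rcases le_total i j with h | h
    · exact (key i j h).symm
    · exact key j i h

theorem delete_mem_pure {n : ℕ} (a : Fin (n + 1)) {β : BraidGroup (n + 1)}
    (hβ : β ∈ pure (n + 1)) : delete a β ∈ pure n := by
  rw [mem_pure_iff] at hβ ⊢
  intro j
  have h := endPos_succAbove β a j
  rw [hβ, hβ] at h
  exact (Fin.succAbove_right_injective h).symm

/-- Generation passes from `n` to `n + 1` strands: deletion is a homomorphism on Cohen braids whose
kernel is the group of Brunnian braids, so generators of the image, once lifted, and of the
kernel generate. -/
theorem le_closure_of_delete {n : ℕ} {K : Subgroup (BraidGroup (n + 1))} (hK : K ≤ cohen (n + 1))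
    {S : Set (BraidGroup (n + 1))} {S' : Set (BraidGroup n)} (hS : S ⊆ K)
    (hd : ∀ β ∈ K, delete 0 β ∈ Subgroup.closure S') (hlift : ∀ g ∈ S', ∃ h ∈ S, delete 0 h = g)
    (hb : brunnian (n + 1) ≤ Subgroup.closure S) : K ≤ Subgroup.closure S := by
  have hSK : Subgroup.closure S ≤ K := (Subgroup.closure_le K).mpr hS
  have lift : ∀ x ∈ Subgroup.closure S', ∃ y ∈ Subgroup.closure S, delete 0 y = x := by
    intro x hx
    induction hx using Subgroup.closure_induction with
    | mem x hx =>
      obtain ⟨y, hy, rfl⟩ := hlift x hx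
      exact ⟨y, Subgroup.subset_closure hy, rfl⟩
    | one => exact ⟨1, one_mem _, delete_one 0⟩
    | mul x y _ _ hx hy =>
      obtain ⟨x', hx', rfl⟩ := hx
      obtain ⟨y', hy', rfl⟩ := hy
      exact ⟨x' * y', mul_mem hx' hy', delete_mul_of_mem_cohen 0 x' (hK (hSK hy'))⟩
    | inv x _ hx =>
      obtain ⟨x', hx', rfl⟩ := hx
      exact ⟨x'⁻¹, inv_mem hx', delete_inv_of_mem_cohen 0 (hK (hSK hx'))⟩
  intro β hβ
  obtain ⟨γ, hγ, he⟩ := lift _ (hd β hβ)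
  have hγc := hK (hSK hγ)
  have hbr : β * γ⁻¹ ∈ brunnian (n + 1) := by
    intro i
    have h0 : delete 0 (β * γ⁻¹) = 1 := by
      rw [delete_mul_of_mem_cohen 0 β (inv_mem hγc), delete_inv_of_mem_cohen 0 hγc, he,
        mul_inv_cancel]
    exact (mul_mem (hK hβ) (inv_mem hγc) i 0).trans h0
  simpa using mul_mem (hb hbr) hγ

/-! ### Generators of the Cohen groups -/

theorem halfTwist_two : halfTwist 2 = σ 2 0 := by simp [halfTwist]

theorem mem_zpowers_halfTwist_two (β : BraidGroup 2) : β ∈ Subgroup.zpowers (halfTwist 2) := by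
  induction β using induction_σ with
  | one => exact one_mem _
  | gen j hj =>
    obtain rfl : j = 0 := by omega
    rw [halfTwist_two]
    exact Subgroup.mem_zpowers _
  | mul β γ hβ hγ => exact mul_mem hβ hγ
  | inv β hβ => exact inv_mem hβ

theorem pure_two_le : pure 2 ≤ Subgroup.zpowers (halfTwist 2 ^ 2) := by
  intro β hβ
  obtain ⟨k, rfl⟩ := mem_zpowers_halfTwist_two β
  rcases Int.even_or_odd' k with ⟨l, rfl | rfl⟩
  · exact ⟨l, by simp [zpow_mul]⟩
  · simp only [zpow_add, zpow_mul, zpow_ofNat, pow_one] at hβ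
    rw [Subgroup.mul_mem_cancel_left _ (zpow_mem (halfTwist_sq_mem_pure 2) l), mem_pure_iff] at hβ
    have h := congrArg Fin.val (hβ 0)
    rw [endPos_halfTwist_val] at h
    simp at h

/-- The braids `T_{m,n}(α)` for `3 ≤ m ≤ n` and `α ∈ GB m`. -/
def stableGens (GB : (m : ℕ) → Set (BraidGroup m)) (n : ℕ) : Set (BraidGroup n) :=
  {g | ∃ (m : ℕ) (h : m ≤ n), 3 ≤ m ∧ ∃ α ∈ GB m, T h α = g}

theorem T_mem_pureCohen {m n : ℕ} (h : m ≤ n) (hm : 3 ≤ m) {α : BraidGroup m}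
    (hα : α ∈ brunnian m) : T h α ∈ pureCohen n := by
  obtain ⟨s, rfl⟩ := Nat.exists_eq_add_of_le h
  have hp := brunnian_le_pure hm hα
  exact ⟨T_mem_cohen hα hp, T_mem_pure hp⟩

theorem delete_T_of_le {m n : ℕ} (h : m ≤ n) (hm : 3 ≤ m) {α : BraidGroup m}
    (hα : α ∈ brunnian m) (i : Fin (n + 1)) : delete i (T (h.trans n.le_succ) α) = T h α := by
  obtain ⟨s, rfl⟩ := Nat.exists_eq_add_of_le h
  exact delete_T hα (brunnian_le_pure hm hα) i

section
variable {GB : (m : ℕ) → Set (BraidGroup m)} {n : ℕ}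

theorem stableGens_subset (h : ∀ m, 3 ≤ m → m ≤ n → Subgroup.closure (GB m) = brunnian m) :
    stableGens GB n ⊆ pureCohen n := by
  rintro g ⟨m, hmn, hm, α, hα, rfl⟩
  exact T_mem_pureCohen hmn hm (h m hm hmn ▸ Subgroup.subset_closure hα)

theorem exists_delete_eq_of_mem_stableGens
    (h : ∀ m, 3 ≤ m → m ≤ n + 1 → Subgroup.closure (GB m) = brunnian m) {g : BraidGroup n}
    (hg : g ∈ stableGens GB n) : ∃ g' ∈ stableGens GB (n + 1), delete 0 g' = g := by
  obtain ⟨m, hmn, hm, α, hα, rfl⟩ := hg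
  exact ⟨_, ⟨m, hmn.trans n.le_succ, hm, α, hα, rfl⟩,
    delete_T_of_le hmn hm (h m hm (hmn.trans n.le_succ) ▸ Subgroup.subset_closure hα) 0⟩

theorem brunnian_le_closure_stableGens (hn : 3 ≤ n)
    (h : Subgroup.closure (GB n) = brunnian n) :
    brunnian n ≤ Subgroup.closure (stableGens GB n) := by
  rw [← h, Subgroup.closure_le]
  exact fun α hα => Subgroup.subset_closure ⟨n, le_rfl, hn, α, hα, T_self _ α⟩

/-- Induction on the number of strands for the pure and the full Cohen groups `K` at once: together
with the stable braids, a family of elements `t` generates as soon as deletion preserves it and it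
generates on two strands. -/
theorem closure_insert_stableGens {K : (n : ℕ) → Subgroup (BraidGroup n)}
    {t : (n : ℕ) → BraidGroup n} (hKc : ∀ n, K n ≤ cohen n) (hpK : ∀ n, pureCohen n ≤ K n)
    (ht : ∀ n, t n ∈ K n) (hdt : ∀ n, delete 0 (t (n + 1)) = t n)
    (hdK : ∀ n, ∀ β ∈ K (n + 1), delete 0 β ∈ K n) (htwo : K 2 ≤ Subgroup.zpowers (t 2))
    (hn : 2 ≤ n) (h : ∀ m, 3 ≤ m → m ≤ n → Subgroup.closure (GB m) = brunnian m) :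
    Subgroup.closure ({t n} ∪ stableGens GB n) = K n := by
  induction n, hn using Nat.le_induction with
  | base =>
    have hsub : {t 2} ∪ stableGens GB 2 ⊆ K 2 :=
      Set.union_subset (Set.singleton_subset_iff.mpr (ht 2)) ((stableGens_subset h).trans (hpK 2))
    exact le_antisymm ((Subgroup.closure_le _).mpr hsub)
      (htwo.trans (Subgroup.zpowers_le.mpr (Subgroup.subset_closure (Or.inl rfl))))
  | succ n hn ih =>
    have hsub : {t (n + 1)} ∪ stableGens GB (n + 1) ⊆ K (n + 1) :=
      Set.union_subset (Set.singleton_subset_iff.mpr (ht _)) ((stableGens_subset h).trans (hpK _))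
    have ih' := ih fun m hm hmn => h m hm (hmn.trans n.le_succ)
    refine le_antisymm ((Subgroup.closure_le _).mpr hsub)
      (le_closure_of_delete (hKc _) hsub (fun β hβ => ih' ▸ hdK n β hβ) ?_
        ((brunnian_le_closure_stableGens (by omega) (h _ (by omega) le_rfl)).trans
          (Subgroup.closure_mono Set.subset_union_right)))
    rintro g (rfl | hg)
    · exact ⟨_, Or.inl rfl, hdt n⟩
    · obtain ⟨g', hg', he⟩ := exists_delete_eq_of_mem_stableGens h hg
      exact ⟨g', Or.inr hg', he⟩

theorem closure_eq_pureCohen (hn : 2 ≤ n)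
    (h : ∀ m, 3 ≤ m → m ≤ n → Subgroup.closure (GB m) = brunnian m) :
    Subgroup.closure ({halfTwist n ^ 2} ∪ stableGens GB n) = pureCohen n := by
  refine closure_insert_stableGens (K := pureCohen) (t := fun n => halfTwist n ^ 2)
    (fun _ => inf_le_left) (fun _ => le_rfl)
    (fun n => ⟨pow_mem (halfTwist_mem_cohen n) 2, halfTwist_sq_mem_pure n⟩) (fun n => ?_)
    (fun n β hβ => ⟨delete_mem_cohen 0 hβ.1, delete_mem_pure 0 hβ.2⟩)
    (inf_le_right.trans pure_two_le) hn h
  rw [pow_two, delete_mul_of_mem_cohen _ _ (halfTwist_mem_cohen _), delete_halfTwist, pow_two]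

theorem closure_eq_cohen (hn : 2 ≤ n)
    (h : ∀ m, 3 ≤ m → m ≤ n → Subgroup.closure (GB m) = brunnian m) :
    Subgroup.closure ({halfTwist n} ∪ stableGens GB n) = cohen n :=
  closure_insert_stableGens (K := cohen) (t := halfTwist) (fun _ => le_rfl) (fun _ => inf_le_left)
    halfTwist_mem_cohen (fun _ => delete_halfTwist 0) (fun _ _ hβ => delete_mem_cohen 0 hβ)
    (fun β _ => mem_zpowers_halfTwist_two β) hn h

end

end BraidGroup

theorem mainTheorem6 (n : ℕ) (hn : 3 ≤ n) :
    (∀ (m : ℕ) (h : m ≤ n), 3 ≤ m → ∀ α ∈ BraidGroup.brunnian m,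
      BraidGroup.T h α ∈ BraidGroup.pureCohen n) ∧
    (∀ (m : ℕ) (h : m ≤ n - 1), 3 ≤ m → ∀ α ∈ BraidGroup.brunnian m, ∀ i : Fin n,
      BraidGroup.del i (BraidGroup.T (h.trans (Nat.sub_le n 1)) α) = BraidGroup.T h α) ∧
    ∀ GB : (m : ℕ) → Set (BraidGroup m),
      (∀ m, 3 ≤ m → m ≤ n → Subgroup.closure (GB m) = BraidGroup.brunnian m) →
      Subgroup.closure ({BraidGroup.halfTwist n ^ 2} ∪
          {g | ∃ (m : ℕ) (h : m ≤ n), 3 ≤ m ∧ ∃ α ∈ GB m, BraidGroup.T h α = g}) =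
        BraidGroup.pureCohen n ∧
      Subgroup.closure ({BraidGroup.halfTwist n} ∪
          {g | ∃ (m : ℕ) (h : m ≤ n), 3 ≤ m ∧ ∃ α ∈ GB m, BraidGroup.T h α = g}) =
        BraidGroup.cohen n := by
  obtain ⟨n, rfl⟩ : ∃ k, n = k + 1 := ⟨n - 1, by omega⟩
  exact ⟨fun m h hm α hα => BraidGroup.T_mem_pureCohen h hm hα,
    fun m h hm α hα i => BraidGroup.delete_T_of_le (n := n) h hm hα i,
    fun GB h => ⟨BraidGroup.closure_eq_pureCohen (by omega) h,
      BraidGroup.closure_eq_cohen (by omega) h⟩⟩
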